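/- Let $(X,d)$ be a computable metric space, that is, a metric space with a dense sequence $\xi:\mathbb{N}\to X$ such that the real double sequence $(a,b)\mapsto d(\xi(a),\xi(b))$ is computable. Let $X$ also carry a group structure $(X,e,\circ,\cdot^{-1})$ that makes it a compact topological group with respect to $d$, and suppose that $d$ is bi-invariant: $$d(a\circ c,\,b\circ c)=d(a,b)=d(c\circ a,\,c\circ b)\qquad\text{for all } a,b,c\in X .$$ (The group operations are not assumed to be computable.) For $n\in\mathbb{N}$ let $\kappa_X(n)$ be the size of a maximum $n$-packing of $X$, that is, the maximal cardinality of a set $T\subseteq X$ with $d(x,y)>2^{-n}$ for all distinct $x,y\in T$. Suppose that $\kappa_X:\mathbb{N}\to\mathbb{N}$ is computable. Let $\mu$ be the Haar measure of $X$, the unique left-invariant Borel probability measure. Then the Haar integral $\mathcal{C}(X)\ni f\mapsto\int_X f\,d\mu\in\mathbb{R}$ is computable. That is, a single algorithm (a computable operator on infinite sequences of natural numbers) turns every name of every continuous $f:X\to\mathbb{R}$ into a name of the real number $\int_X f\,d\mu$. Here a name of a point $x\in X$ is a sequence $p\in\mathbb{N}^{\mathbb{N}}$ with $d(\xi(p_i),x)\le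 2^{-i}$ for all $i$; a name of a real number $y$ is, likewise, a sequence of codes of rational numbers $q_0,q_1,\dots$ with $|q_i-y|\le 2^{-i}$ for all $i$; and a name of $f$ is a sequence that encodes (as an associate in the sense of Kleene) a continuous operator on infinite sequences which maps every name of every $x\in X$ to a name of $f(x)$. -/

import Mathlib

open MeasureTheory Metric
open scoped NNReal Topology

namespace HaarComp

/-- A representation of a set `A`: a partial surjection from Baire space `ℕ → ℕ` onto `A`, given by
its graph.  `IsName p a` says that the infinite sequence `p` encodes `a`. -/
structure Representation (A : Type*) where
  IsName : (ℕ → ℕ) → A → Prop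
  functional : ∀ p a b, IsName p a → IsName p b → a = b
  surjective : ∀ a, ∃ p, IsName p a

/-- The initial segment `[p 0, …, p (k - 1)]`. -/
def initSeg (p : ℕ → ℕ) (k : ℕ) : List ℕ := (List.range k).map p

/-- Application of a (Kleene) associate `α` to an infinite sequence `p`: the algorithm described by
`α` is run on longer and longer initial segments of `p`; for the `n`-th output entry, the answer `0`
means "read one more entry of the input", and the first answer that is not `0`, say `m + 1`,
means "the output is `m`".  `Applies α p q` says that this produces the total sequence `q`. -/
def Applies (α p q : ℕ → ℕ) : Prop :=
  ∀ n, ∃ k, α (Encodable.encode (n :: initSeg p k)) = q n + 1 ∧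
    ∀ j < k, α (Encodable.encode (n :: initSeg p j)) = 0

/-- The operator on Baire space with associate `α` realizes `F : A → B`: it maps every name
of every `a` to a name of `F a`. -/
def Realizes {A B : Type*} (δ : Representation A) (ε : Representation B) (α : ℕ → ℕ)
    (F : A → B) : Prop :=
  ∀ p a, δ.IsName p a → ∃ q, Applies α p q ∧ ε.IsName q (F a)

/-- A map between represented sets is computable if some operator on Baire space with a computable
associate (equivalently, some oracle or Type-2 machine) realizes it. -/
def ComputableMap {A B : Type*} (δ : Representation A) (ε : Representation B) (F : A → B) : Prop :=
  ∃ α : ℕ → ℕ, Computable α ∧ Realizes δ ε α F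

lemma Applies.unique {α p q q' : ℕ → ℕ} (h : Applies α p q) (h' : Applies α p q') : q = q' := by
  funext n
  obtain ⟨k, hk, hlt⟩ := h n
  obtain ⟨k', hk', hlt'⟩ := h' n
  rcases lt_trichotomy k k' with hkk | hkk | hkk
  · have := hlt' k hkk
    omega
  · subst hkk
    omega
  · have := hlt k' hkk
    omega

/-- The Cauchy representation of a metric space with dense sequence `ξ`: a name of `x` is a
sequence of indices of points `ξ (p 0), ξ (p 1), …` converging rapidly to `x`. -/
def cauchyRep {X : Type*} [MetricSpace X] (ξ : ℕ → X) (hξ : DenseRange ξ) : Representation X where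
  IsName p x := ∀ i, dist (ξ (p i)) x ≤ (1 / 2 : ℝ) ^ i
  functional := by
    intro p x y hx hy
    have h0 : Filter.Tendsto (fun i : ℕ => (1 / 2 : ℝ) ^ i) Filter.atTop (𝓝 0) :=
      tendsto_pow_atTop_nhds_zero_of_lt_one (by norm_num) (by norm_num)
    have tx : Filter.Tendsto (fun i => ξ (p i)) Filter.atTop (𝓝 x) :=
      tendsto_iff_dist_tendsto_zero.2 (squeeze_zero (fun _ => dist_nonneg) hx h0)
    have ty : Filter.Tendsto (fun i => ξ (p i)) Filter.atTop (𝓝 y) :=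
      tendsto_iff_dist_tendsto_zero.2 (squeeze_zero (fun _ => dist_nonneg) hy h0)
    exact tendsto_nhds_unique tx ty
  surjective := by
    intro x
    have h : ∀ i : ℕ, ∃ a, dist x (ξ a) < (1 / 2 : ℝ) ^ i :=
      fun i => hξ.exists_dist_lt x (by positivity)
    choose p hp using h
    exact ⟨p, fun i => by rw [dist_comm]; exact (hp i).le⟩

/-- Every continuous map between metric spaces with dense sequences has an associate, with respect
to the Cauchy representations. -/
lemma exists_realizes {X Y : Type*} [MetricSpace X] [MetricSpace Y] (ξ : ℕ → X)
    (hξ : DenseRange ξ) (υ : ℕ → Y) (hυ : DenseRange υ) (f : C(X, Y)) :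
    ∃ α, Realizes (cauchyRep ξ hξ) (cauchyRep υ hυ) α f := by
  classical
  let good : ℕ → List ℕ → ℕ → Prop := fun n l m =>
    ∀ x, (∀ i a, l[i]? = some a → dist (ξ a) x ≤ (1 / 2 : ℝ) ^ i) →
      dist (υ m) (f x) ≤ (1 / 2 : ℝ) ^ n
  let β : List ℕ → ℕ := fun w =>
    match w with
    | [] => 0
    | n :: l => if h : ∃ m, good n l m then h.choose + 1 else 0
  refine ⟨fun c => β ((Encodable.decode c).getD []), ?_⟩
  intro p x hp
  have hget : ∀ k i a, (initSeg p k)[i]? = some a → a = p i := by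
    intro k i a h
    simp only [initSeg, List.getElem?_map, Option.map_eq_some_iff] at h
    obtain ⟨j, hj, rfl⟩ := h
    obtain ⟨_, hj⟩ := List.getElem?_eq_some_iff.1 hj
    simp only [List.getElem_range] at hj
    rw [hj]
  have hcomp : ∀ k, ∀ i a, (initSeg p k)[i]? = some a → dist (ξ a) x ≤ (1 / 2 : ℝ) ^ i := by
    intro k i a h
    rw [hget k i a h]
    exact hp i
  have hex : ∀ n, ∃ k, ∃ m, good n (initSeg p k) m := by
    intro n
    obtain ⟨m, hm⟩ := hυ.exists_dist_lt (f x) (ε := (1 / 2 : ℝ) ^ (n + 1)) (by positivity)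
    obtain ⟨r, hr, hball⟩ := Metric.continuousAt_iff.1 (f.continuous.continuousAt (x := x))
      ((1 / 2 : ℝ) ^ (n + 1)) (by positivity)
    obtain ⟨i, hi⟩ := exists_pow_lt_of_lt_one (show (0 : ℝ) < r / 2 by positivity)
      (show (1 / 2 : ℝ) < 1 by norm_num)
    refine ⟨i + 1, m, fun y hy => ?_⟩
    have h1 := hy i (p i) (by simp [initSeg])
    have h2 : dist (ξ (p i)) x ≤ (1 / 2 : ℝ) ^ i := hp i
    have h3 : dist y x < r := by
      have := dist_triangle_left y x (ξ (p i))
      linarith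
    have h4 := hball h3
    have h5 := dist_triangle_right (υ m) (f y) (f x)
    rw [dist_comm] at hm
    rw [pow_succ] at h4 hm
    linarith
  have key : ∀ n k, (∃ m, good n (initSeg p k) m) →
      ∃ v, β (n :: initSeg p k) = v + 1 ∧ dist (υ v) (f x) ≤ (1 / 2 : ℝ) ^ n := by
    intro n k h
    exact ⟨h.choose, by simp only [β]; rw [dif_pos h], h.choose_spec x (hcomp k)⟩
  have main : ∀ n, ∃ v, (∃ k, β (n :: initSeg p k) = v + 1 ∧
      ∀ j < k, β (n :: initSeg p j) = 0) ∧ dist (υ v) (f x) ≤ (1 / 2 : ℝ) ^ n := by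
    intro n
    obtain ⟨v, hv, hd⟩ := key n (Nat.find (hex n)) (Nat.find_spec (hex n))
    refine ⟨v, ⟨_, hv, fun j hj => ?_⟩, hd⟩
    simp only [β]
    rw [dif_neg (Nat.find_min (hex n) hj)]
  choose q hq hd using main
  refine ⟨q, fun n => ?_, hd⟩
  simpa only [Encodable.encodek, Option.getD_some] using hq n

/-- The function space representation of `C(X, Y)`, for metric spaces `X` and `Y` with Cauchy
representations: a name of `f` is an associate of an operator that realizes `f`, that is, a
description of how to compute a name of `f x` from any name of `x`. -/
def functionRep {X Y : Type*} [MetricSpace X] [MetricSpace Y] (ξ : ℕ → X) (hξ : DenseRange ξ)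
    (υ : ℕ → Y) (hυ : DenseRange υ) : Representation C(X, Y) where
  IsName α f := Realizes (cauchyRep ξ hξ) (cauchyRep υ hυ) α f
  functional := by
    intro α f g hf hg
    ext x
    obtain ⟨p, hp⟩ := (cauchyRep ξ hξ).surjective x
    obtain ⟨q, hq, hqf⟩ := hf p x hp
    obtain ⟨q', hq', hqg⟩ := hg p x hp
    rw [hq.unique hq'] at hqf
    exact (cauchyRep υ hυ).functional _ _ _ hqf hqg
  surjective := exists_realizes ξ hξ υ hυ

/-- The standard numbering of the rational numbers: the code `⟨⟨a, b⟩, c⟩` (with the Cantor pairing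
function) stands for `(a - b) / (c + 1)`. -/
noncomputable def ratCode (m : ℕ) : ℝ :=
  (((m.unpair.1.unpair.1 : ℝ) - (m.unpair.1.unpair.2 : ℝ)) / ((m.unpair.2 : ℝ) + 1))

lemma denseRange_ratCode : DenseRange ratCode := by
  have h : Set.range ((↑) : ℚ → ℝ) ⊆ Set.range ratCode := by
    rintro _ ⟨r, rfl⟩
    refine ⟨Nat.pair (Nat.pair r.num.toNat (-r.num).toNat) (r.den - 1), ?_⟩
    have h1 : ((r.num.toNat : ℝ) - ((-r.num).toNat : ℝ)) = (r.num : ℝ) := by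
      exact_mod_cast Int.toNat_sub_toNat_neg r.num
    have h2 : ((r.den - 1 : ℕ) : ℝ) + 1 = (r.den : ℝ) := by
      exact_mod_cast Nat.sub_add_cancel r.den_pos
    simp only [ratCode, Nat.unpair_pair]
    rw [h1, h2, Rat.cast_def]
  exact Rat.denseRange_cast.mono h

/-- The standard representation of the real numbers by rapidly converging sequences of rationals. -/
noncomputable def realRep : Representation ℝ := cauchyRep ratCode denseRange_ratCode

/-- A computable metric space: a metric space with a dense sequence `ξ` such that the real double
sequence `(a, b) ↦ dist (ξ a) (ξ b)` is computable. -/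
structure ComputableMetricSpace (X : Type*) [MetricSpace X] where
  ξ : ℕ → X
  dense : DenseRange ξ
  computable_dist : ∃ D : ℕ → ℕ → ℕ → ℕ,
    Computable (fun t : ℕ × ℕ × ℕ => D t.1 t.2.1 t.2.2) ∧
      ∀ a b, realRep.IsName (D a b) (dist (ξ a) (ξ b))

/-- The representation of the space of continuous real functions on a computable metric space. -/
noncomputable def ComputableMetricSpace.functionRep {X : Type*} [MetricSpace X]
    (S : ComputableMetricSpace X) : Representation C(X, ℝ) :=
  HaarComp.functionRep S.ξ S.dense ratCode denseRange_ratCode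

/-- The size `κ_X` of maximum packings of `X`: the maximal number of points of `X` with
pairwise distances `> 2⁻ⁿ` (a natural number for every `n` if `X` is compact). -/
noncomputable def packingSize (X : Type*) [MetricSpace X] (n : ℕ) : ℕ :=
  (packingNumber ((1 / 2 : ℝ≥0) ^ n) (Set.univ : Set X)).toNat

end HaarComp

/-!
Let `T` be a maximum packing for the radius `ε = 2⁻ⁿ`, that is, a set of maximal cardinality `N`
whose points have pairwise distances greater than `ε`.  For every `c`, the translate `T * c` is a
maximum packing as well, because the metric is invariant.  Two maximum packings are matched by a
bijection that moves every point by at most `ε` (`exists_perm_dist_le`): by Hall's theorem, the only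
obstacle would be a subset `A` of the first packing with fewer than `|A|` neighbours in the second,
and exchanging these neighbours for `A` would give a packing with more than `N` points.  So if
`v t` approximates `f` up to `δ` on the closed `ε`-ball around each `t ∈ T`, then the average of `v`
is within `δ` of the average of `f` over `T * c`.  Integrating over `c` turns the latter average
into the Haar integral of `f`, by left invariance of the measure
(`abs_average_sub_integral_le`).

The values `v t` are read off a name `α` of `f`.  If the associate `α` produces its `m`-th output
entry after reading the word `w`, then this output is correct up to `2⁻ᵐ` for every `y` that has a
name beginning with `w` (`dist_output_le`).  By compactness there is an `n` such that every closed
ball of radius `2⁻ⁿ` is covered by a single such word with strict inequalities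
(`exists_uniform_haltsOn`), and by density maximum packings can be chosen among the points of the
dense sequence (`exists_dense_packing`).

The algorithm therefore searches for a certificate: a radius `2⁻ⁿ`, as many indices of points as
`packingSize X n` prescribes, and a word for each of them.  That the points form a packing and
that the words cover the balls follows from inequalities between rational approximations of
distances, so it can be tested; the size of the packing, known to be maximal since the packing sizes
are computable, replaces any computation with the group operations.  A certificate that passes the
test gives a correct output (`abs_ratCode_average_sub_integral_le`), and some certificate does pass
(`exists_test`).
-/

namespace HaarComp

/-! ### Averages over maximum packings -/

lemma injective_of_pairwise_lt_dist {X ι : Type*} [MetricSpace X] {ε : ℝ} (hε : 0 ≤ ε) {a : ι → X}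
    (ha : Pairwise fun i j => ε < dist (a i) (a j)) : Function.Injective a := by
  intro i j hij
  by_contra hne
  have : ε < dist (a i) (a j) := ha hne
  rw [hij, dist_self] at this
  linarith

/-- Two maximum packings are matched by a bijection that moves every point by at most the packing
radius.  This is Hall's marriage theorem for the relation of being at most `ε` apart. -/
lemma exists_perm_dist_le {X : Type*} [MetricSpace X] {ε : ℝ} (hε : 0 ≤ ε) {N : ℕ}
    (hN : ∀ T : Finset X, (T : Set X).Pairwise (fun x y => ε < dist x y) → T.card ≤ N)
    {a b : Fin N → X} (ha : Pairwise fun i j => ε < dist (a i) (a j))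
    (hb : Pairwise fun i j => ε < dist (b i) (b j)) :
    ∃ σ : Equiv.Perm (Fin N), ∀ i, dist (a i) (b (σ i)) ≤ ε := by
  classical
  let t : Fin N → Finset (Fin N) := fun i => Finset.univ.filter fun j => dist (a i) (b j) ≤ ε
  have hall : ∀ s : Finset (Fin N), s.card ≤ (s.biUnion t).card := by
    intro s
    -- Exchanging the neighbours of `a '' s` in `b` for `a '' s` gives another packing.
    have hfar : ∀ i ∈ s, ∀ j ∈ (s.biUnion t)ᶜ, ε < dist (a i) (b j) := by
      intro i hi j hj
      by_contra hle
      exact Finset.mem_compl.1 hj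
        (Finset.mem_biUnion.2 ⟨i, hi, Finset.mem_filter.2 ⟨Finset.mem_univ _, not_lt.1 hle⟩⟩)
    have hcard := hN (s.image a ∪ (s.biUnion t)ᶜ.image b) (by
      intro x hx y hy hxy
      simp only [Finset.coe_union, Finset.coe_image, Set.mem_union, Set.mem_image,
        Finset.mem_coe] at hx hy
      rcases hx with ⟨i, hi, rfl⟩ | ⟨i, hi, rfl⟩ <;> rcases hy with ⟨j, hj, rfl⟩ | ⟨j, hj, rfl⟩
      · exact ha fun h => hxy (h ▸ rfl)
      · exact hfar i hi j hj
      · rw [dist_comm]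
        exact hfar j hj i hi
      · exact hb fun h => hxy (h ▸ rfl))
    rw [Finset.card_union_of_disjoint, Finset.card_image_of_injective _
      (injective_of_pairwise_lt_dist hε ha), Finset.card_image_of_injective _
      (injective_of_pairwise_lt_dist hε hb), Finset.card_compl, Fintype.card_fin] at hcard
    · have := Finset.card_le_univ (s.biUnion t)
      rw [Fintype.card_fin] at this
      omega
    · rw [Finset.disjoint_left]
      intro x hx hy
      obtain ⟨i, hi, rfl⟩ := Finset.mem_image.1 hx
      obtain ⟨j, hj, hji⟩ := Finset.mem_image.1 hy
      have := hfar i hi j hj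
      rw [hji, dist_self] at this
      linarith
  obtain ⟨σ, hσ, hmem⟩ := (Finset.all_card_le_biUnion_card_iff_exists_injective t).1 hall
  refine ⟨Equiv.ofBijective σ (Finite.injective_iff_bijective.1 hσ), fun i => ?_⟩
  exact (Finset.mem_filter.1 (hmem i)).2

/-- If `v i` approximates `f` up to `δ` on the closed `ε`-ball around the `i`-th point of a maximum
packing, then the average of `v` approximates the Haar integral of `f` up to `δ`. -/
lemma abs_average_sub_integral_le {X : Type*} [MetricSpace X] [CompactSpace X] [Group X]
    [IsTopologicalGroup X] [MeasurableSpace X] [BorelSpace X]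
    (hinv : ∀ a b c : X, dist (a * c) (b * c) = dist a b)
    (μ : Measure X) [IsProbabilityMeasure μ] [μ.IsMulLeftInvariant] (f : C(X, ℝ))
    {ε δ : ℝ} (hε : 0 ≤ ε) {N : ℕ} (hN0 : N ≠ 0)
    (hN : ∀ T : Finset X, (T : Set X).Pairwise (fun x y => ε < dist x y) → T.card ≤ N)
    {a : Fin N → X} (ha : Pairwise fun i j => ε < dist (a i) (a j)) {v : Fin N → ℝ}
    (hv : ∀ i y, dist (a i) y ≤ ε → |v i - f y| ≤ δ) :
    |(∑ i, v i) / N - ∫ x, f x ∂μ| ≤ δ := by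
  have hNpos : (0 : ℝ) < N := by exact_mod_cast Nat.pos_of_ne_zero hN0
  have hint : ∀ g : C(X, ℝ), Integrable (fun x => g x) μ := fun g =>
    g.continuous.integrable_of_hasCompactSupport (HasCompactSupport.of_compactSpace _)
  have hint' : ∀ i, Integrable (fun c => f (a i * c)) μ := fun i =>
    hint (f.comp ⟨fun c => a i * c, continuous_const_mul (a i)⟩)
  have htrans : ∀ c, |(∑ i, v i) / N - (∑ i, f (a i * c)) / N| ≤ δ := by
    intro c
    obtain ⟨σ, hσ⟩ := exists_perm_dist_le hε hN ha (b := fun i => a i * c)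
      (fun i j hij => (ha hij).trans_eq (hinv _ _ _).symm)
    rw [← Equiv.sum_comp σ fun i => f (a i * c), ← sub_div, ← Finset.sum_sub_distrib, abs_div,
      abs_of_pos hNpos, div_le_iff₀ hNpos]
    calc |∑ i, (v i - f (a (σ i) * c))| ≤ ∑ i, |v i - f (a (σ i) * c)| :=
          Finset.abs_sum_le_sum_abs _ _
      _ ≤ ∑ _i : Fin N, δ := Finset.sum_le_sum fun i _ => hv i _ (hσ i)
      _ = δ * N := by simp [mul_comm]
  have hmean : ∫ c, (∑ i, f (a i * c)) / N ∂μ = ∫ x, f x ∂μ := by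
    rw [integral_div, integral_finsetSum _ fun i _ => hint' i]
    simp only [integral_mul_left_eq_self (fun x => f x)]
    simp [hNpos.ne']
  have hsum : Integrable (fun c => (∑ i, f (a i * c)) / (N : ℝ)) μ :=
    (integrable_finsetSum _ fun i _ => hint' i).div_const _
  have h := norm_integral_le_of_norm_le_const (μ := μ)
    (f := fun c => (∑ i, v i) / N - (∑ i, f (a i * c)) / N) (C := δ)
    (Filter.Eventually.of_forall htrans)
  rw [integral_sub (integrable_const _) hsum, hmean] at h
  simpa using h

/-! ### Maximum packings by points of the dense sequence -/

lemma packingNumber_univ_ne_top {X : Type*} [MetricSpace X] [CompactSpace X] {ε : ℝ≥0}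
    (hε : ε ≠ 0) : packingNumber ε (Set.univ : Set X) ≠ ⊤ := by
  obtain ⟨C, -, hfin, hC⟩ := exists_finite_isCover_of_isCompact (ε := ε / 2) (by positivity)
    (isCompact_univ (X := X))
  have h := (packingNumber_two_mul_le_externalCoveringNumber (ε / 2) (Set.univ : Set X)).trans
    hC.externalCoveringNumber_le_encard
  rw [mul_div_cancel₀ _ two_ne_zero] at h
  exact ne_top_of_le_ne_top (Set.encard_ne_top_iff.2 hfin) h

lemma packingSize_ne_zero {X : Type*} [MetricSpace X] [CompactSpace X] [Nonempty X] (n : ℕ) :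
    packingSize X n ≠ 0 := by
  rw [packingSize, Ne, ENat.toNat_eq_zero, not_or]
  exact ⟨by simp, packingNumber_univ_ne_top (by positivity)⟩

lemma lt_edist_iff {X : Type*} [MetricSpace X] (n : ℕ) (x y : X) :
    (((1 / 2 : ℝ≥0) ^ n : ℝ≥0) : ENNReal) < edist x y ↔ (1 / 2 : ℝ) ^ n < dist x y := by
  rw [edist_nndist, ENNReal.coe_lt_coe, ← NNReal.coe_lt_coe, coe_nndist]
  push_cast
  rfl

lemma card_le_packingSize {X : Type*} [MetricSpace X] [CompactSpace X] (n : ℕ) (T : Finset X)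
    (hT : (T : Set X).Pairwise fun x y => (1 / 2 : ℝ) ^ n < dist x y) :
    T.card ≤ packingSize X n := by
  have h : IsSeparated (((1 / 2 : ℝ≥0) ^ n : ℝ≥0) : ENNReal) (T : Set X) :=
    fun x hx y hy hxy => (lt_edist_iff n x y).2 (hT hx hy hxy)
  have h' := h.encard_le_packingNumber (Set.subset_univ _)
  rw [Set.encard_coe_eq_coe_finsetCard] at h'
  exact ENat.toNat_le_toNat h' (packingNumber_univ_ne_top (by positivity))

/-- Maximum packings exist within any dense sequence, since distances are required to be strictly
greater than the packing radius. -/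
lemma exists_dense_packing {X : Type*} [MetricSpace X] [CompactSpace X] {ξ : ℕ → X}
    (hξ : DenseRange ξ) (n : ℕ) :
    ∃ a : Fin (packingSize X n) → ℕ,
      Pairwise fun i j => (1 / 2 : ℝ) ^ n < dist (ξ (a i)) (ξ (a j)) := by
  obtain ⟨C, -, hfin, hsep, hcard⟩ := exists_set_encard_eq_packingNumber
    (packingNumber_univ_ne_top (X := X) (ε := (1 / 2 : ℝ≥0) ^ n) (by positivity))
  have hC : Nat.card C = packingSize X n := by
    rw [packingSize, ← hcard, Nat.card_coe_set_eq, Set.ncard]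
  have := hfin.to_subtype
  let e : Fin (packingSize X n) ≃ C := (Finite.equivFinOfCardEq hC).symm
  -- Being a packing is an open condition on tuples.
  let U : Set (Fin (packingSize X n) → X) :=
    {x | ∀ i j, i ≠ j → (1 / 2 : ℝ) ^ n < dist (x i) (x j)}
  have hU : IsOpen U := by
    simp only [U, Set.ofPred_forall]
    refine isOpen_iInter_of_finite fun i => isOpen_iInter_of_finite fun j =>
      isOpen_iInter_of_finite fun _ => isOpen_lt continuous_const ?_
    exact (continuous_apply i).dist (continuous_apply j)
  have hne : U.Nonempty := ⟨fun i => e i, fun i j hij => (lt_edist_iff n _ _).1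
    (hsep (e i).2 (e j).2 fun h => hij (e.injective (Subtype.ext h)))⟩
  obtain ⟨x, hx, a, rfl⟩ :=
    (DenseRange.piMap fun _ : Fin (packingSize X n) => hξ).inter_open_nonempty U hU hne
  exact ⟨a, fun i j hij => hx i j hij⟩

/-! ### Associates on finite words -/

/-- The associate `α` produces its `m`-th output entry after reading exactly the word `w`. -/
def HaltsOn (α : ℕ → ℕ) (m : ℕ) (w : List ℕ) : Prop :=
  α (Encodable.encode (m :: w)) ≠ 0 ∧
    ∀ j < w.length, α (Encodable.encode (m :: w.take j)) = 0

lemma initSeg_eq_take {p : ℕ → ℕ} {w : List ℕ} (hp : ∀ j < w.length, p j = w.getD j 0) {j : ℕ}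
    (hj : j ≤ w.length) : initSeg p j = w.take j := by
  refine List.ext_getElem (by simp [initSeg, hj]) fun i h1 h2 => ?_
  have hi : i < w.length := by
    simp only [List.length_take] at h2
    omega
  simp [initSeg, hp i hi, hi]

lemma take_initSeg (p : ℕ → ℕ) {j k : ℕ} (hj : j ≤ k) : (initSeg p k).take j = initSeg p j := by
  rw [initSeg, ← List.map_take, List.take_range, min_eq_left hj, initSeg]

lemma length_initSeg (p : ℕ → ℕ) (k : ℕ) : (initSeg p k).length = k := by
  simp [initSeg]

lemma getD_initSeg (p : ℕ → ℕ) {j k : ℕ} (hj : j < k) : (initSeg p k).getD j 0 = p j := by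
  simp [initSeg, hj]

lemma getElem?_initSeg_eq_some_iff (p : ℕ → ℕ) {j k c : ℕ} :
    (initSeg p k)[j]? = some c ↔ j < k ∧ p j = c := by
  simp [initSeg, List.getElem?_eq_some_iff]

/-- The output of an associate of `f` after reading the word `w` is correct at every point that has
a name beginning with `w`, because the associate cannot distinguish between these points. -/
lemma dist_output_le {X : Type*} [MetricSpace X] {ξ : ℕ → X} {hξ : DenseRange ξ} {f : X → ℝ}
    {α : ℕ → ℕ} (hα : Realizes (cauchyRep ξ hξ) realRep α f) {m : ℕ} {w : List ℕ}
    (hw : HaltsOn α m w) {y : X}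
    (hy : ∀ j < w.length, dist (ξ (w.getD j 0)) y ≤ (1 / 2 : ℝ) ^ j) :
    |ratCode (α (Encodable.encode (m :: w)) - 1) - f y| ≤ (1 / 2 : ℝ) ^ m := by
  obtain ⟨p₀, hp₀⟩ := (cauchyRep ξ hξ).surjective y
  -- The word `w` is continued by a name of `y` to a name of `y`.
  let p : ℕ → ℕ := fun j => if j < w.length then w.getD j 0 else p₀ j
  have hp : (cauchyRep ξ hξ).IsName p y := by
    intro j
    by_cases hj : j < w.length
    · simpa only [p, if_pos hj] using hy j hj
    · simpa only [p, if_neg hj] using hp₀ j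
  obtain ⟨q, hq, hqy⟩ := hα p y hp
  obtain ⟨k, hk, hlt⟩ := hq m
  have htake : ∀ j ≤ w.length, initSeg p j = w.take j := fun j hj =>
    initSeg_eq_take (fun i hi => if_pos hi) hj
  have hkw : k = w.length := by
    rcases lt_trichotomy k w.length with h | h | h
    · rw [htake k h.le, hw.2 k h] at hk
      omega
    · exact h
    · have := hlt _ h
      rw [htake _ le_rfl, List.take_length] at this
      exact absurd this hw.1
  rw [hkw, htake _ le_rfl, List.take_length] at hk
  rw [hk, Nat.add_sub_cancel, ← Real.dist_eq]
  exact hqy m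

/-- For an associate of a real function on a compact space, a single radius `2⁻ⁿ` is such that the
closed ball of this radius around any point consists of points with names beginning with a common
word on which the associate halts.  The strict inequalities are what makes this verifiable from
approximate distances. -/
lemma exists_uniform_haltsOn {X : Type*} [MetricSpace X] [CompactSpace X] {ξ : ℕ → X}
    {hξ : DenseRange ξ} {f : X → ℝ} {α : ℕ → ℕ} (hα : Realizes (cauchyRep ξ hξ) realRep α f)
    (m : ℕ) :
    ∃ n : ℕ, ∀ y, ∃ w, HaltsOn α m w ∧
      ∀ j < w.length, dist (ξ (w.getD j 0)) y + (1 / 2 : ℝ) ^ n < (1 / 2 : ℝ) ^ j := by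
  have hanti : ∀ {i j : ℕ}, i ≤ j → (1 / 2 : ℝ) ^ j ≤ (1 / 2 : ℝ) ^ i := fun h =>
    pow_le_pow_of_le_one (by norm_num) (by norm_num) h
  suffices h : ∃ n : ℕ, ∀ y ∈ (Set.univ : Set X), ∃ w, HaltsOn α m w ∧
      ∀ j < w.length, dist (ξ (w.getD j 0)) y + (1 / 2 : ℝ) ^ n < (1 / 2 : ℝ) ^ j by
    simpa using h
  refine isCompact_univ.induction_on (p := fun A => ∃ n : ℕ, ∀ y ∈ A, ∃ w, HaltsOn α m w ∧
      ∀ j < w.length, dist (ξ (w.getD j 0)) y + (1 / 2 : ℝ) ^ n < (1 / 2 : ℝ) ^ j) ?_ ?_ ?_ ?_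
  · exact ⟨0, fun y hy => absurd hy (Set.notMem_empty y)⟩
  · rintro A B hAB ⟨n, hn⟩
    exact ⟨n, fun y hy => hn y (hAB hy)⟩
  · rintro A B ⟨n, hn⟩ ⟨n', hn'⟩
    refine ⟨max n n', fun y hy => ?_⟩
    rcases hy with hy | hy
    · obtain ⟨w, hw, hd⟩ := hn y hy
      exact ⟨w, hw, fun j hj => by linarith [hd j hj, hanti (le_max_left n n')]⟩
    · obtain ⟨w, hw, hd⟩ := hn' y hy
      exact ⟨w, hw, fun j hj => by linarith [hd j hj, hanti (le_max_right n n')]⟩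
  · intro x _
    -- A name that converges twice as fast as required leaves room for perturbing `x`.
    have hfast : ∀ i : ℕ, ∃ a, dist x (ξ a) < (1 / 2 : ℝ) ^ (i + 1) :=
      fun i => hξ.exists_dist_lt x (by positivity)
    choose p hp using hfast
    have hname : (cauchyRep ξ hξ).IsName p x := fun i => by
      rw [dist_comm]
      exact (hp i).le.trans (hanti i.le_succ)
    obtain ⟨q, hq, -⟩ := hα p x hname
    obtain ⟨k, hk, hlt⟩ := hq m
    refine ⟨ball x ((1 / 2 : ℝ) ^ (k + 1)), mem_nhdsWithin_of_mem_nhds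
      (ball_mem_nhds x (by positivity)), k + 1, fun y hy => ⟨initSeg p k, ⟨by omega, ?_⟩, ?_⟩⟩
    · intro j hj
      rw [length_initSeg] at hj
      rw [take_initSeg p hj.le]
      exact hlt j hj
    · intro j hj
      rw [length_initSeg] at hj
      rw [getD_initSeg p hj]
      have h1 := hp j
      have h2 : dist y x < (1 / 2 : ℝ) ^ (k + 1) := hy
      have h3 := dist_triangle_right (ξ (p j)) y x
      have h4 : (1 / 2 : ℝ) ^ k ≤ (1 / 2 : ℝ) ^ (j + 1) := hanti hj
      rw [dist_comm] at h1
      rw [pow_succ] at h1 h2 h4 ⊢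
      linarith

/-! ### Arithmetic of rational codes -/

/-- A code of the sum of two coded rational numbers. -/
def addCode (u v : ℕ) : ℕ :=
  Nat.pair (Nat.pair
    (u.unpair.1.unpair.1 * (v.unpair.2 + 1) + v.unpair.1.unpair.1 * (u.unpair.2 + 1))
    (u.unpair.1.unpair.2 * (v.unpair.2 + 1) + v.unpair.1.unpair.2 * (u.unpair.2 + 1)))
    ((u.unpair.2 + 1) * (v.unpair.2 + 1) - 1)

/-- A code of the quotient of a coded rational number by a positive integer `k`. -/
def divCode (u k : ℕ) : ℕ :=
  Nat.pair u.unpair.1 ((u.unpair.2 + 1) * k - 1)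

lemma ratCode_addCode (u v : ℕ) : ratCode (addCode u v) = ratCode u + ratCode v := by
  simp only [ratCode, addCode, Nat.unpair_pair]
  rw [Nat.cast_pred (by positivity)]
  push_cast
  field_simp
  ring

lemma ratCode_divCode (u : ℕ) {k : ℕ} (hk : k ≠ 0) : ratCode (divCode u k) = ratCode u / k := by
  have : 0 < k := Nat.pos_of_ne_zero hk
  simp only [ratCode, divCode, Nat.unpair_pair]
  rw [Nat.cast_pred (by positivity)]
  push_cast
  field_simp
  ring

/-- A test for the inequality `2⁻ⁿ + 2⁻ˢ < q` of a coded rational number `q`, with denominators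
cleared. -/
def farTest (q s n : ℕ) : Bool :=
  decide (q.unpair.1.unpair.2 * (2 ^ s * 2 ^ n) + (q.unpair.2 + 1) * (2 ^ s + 2 ^ n) <
    q.unpair.1.unpair.1 * (2 ^ s * 2 ^ n))

/-- A test for the inequality `q + 2⁻ˢ + 2⁻ⁿ ≤ 2⁻ʲ` of a coded rational number `q`, with
denominators cleared. -/
def nearTest (q s n j : ℕ) : Bool :=
  decide (q.unpair.1.unpair.1 * (2 ^ s * 2 ^ n * 2 ^ j) +
      (q.unpair.2 + 1) * (2 ^ n * 2 ^ j + 2 ^ s * 2 ^ j) ≤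
    q.unpair.1.unpair.2 * (2 ^ s * 2 ^ n * 2 ^ j) + (q.unpair.2 + 1) * (2 ^ s * 2 ^ n))

lemma farTest_iff {q s n : ℕ} :
    farTest q s n = true ↔ (1 / 2 : ℝ) ^ n + (1 / 2 : ℝ) ^ s < ratCode q := by
  rw [farTest, decide_eq_true_iff, ← Nat.cast_lt (α := ℝ), ← sub_pos, ← sub_pos (a := ratCode q),
    ← mul_pos_iff_of_pos_left (b := ratCode q - _)
      (show 0 < 2 ^ s * 2 ^ n * ((q.unpair.2 : ℝ) + 1) by positivity)]
  push_cast
  simp only [ratCode, one_div, inv_pow]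
  refine iff_of_eq (congrArg (0 < ·) ?_)
  field_simp
  ring

lemma nearTest_iff {q s n j : ℕ} :
    nearTest q s n j = true ↔ ratCode q + (1 / 2 : ℝ) ^ s + (1 / 2 : ℝ) ^ n ≤ (1 / 2 : ℝ) ^ j := by
  rw [nearTest, decide_eq_true_iff, ← Nat.cast_le (α := ℝ), ← sub_nonneg,
    ← sub_nonneg (a := (1 / 2 : ℝ) ^ j),
    ← mul_nonneg_iff_of_pos_left (b := (1 / 2 : ℝ) ^ j - _)
      (show 0 < 2 ^ s * 2 ^ n * 2 ^ j * ((q.unpair.2 : ℝ) + 1) by positivity)]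
  push_cast
  simp only [ratCode, one_div, inv_pow]
  refine iff_of_eq (congrArg (0 ≤ ·) ?_)
  field_simp
  ring

/-! ### Certificates -/

/-- A certificate `((n, s), L)` proposes a packing and the words on which an associate of the
integrand is to be evaluated: `n` is the index of the packing radius `2⁻ⁿ`, `s` is the precision
with which distances are approximated, and `L` lists pairs of (the index of) a point of the packing
and a word. -/
abbrev Certificate : Type := (ℕ × ℕ) × List (ℕ × List ℕ)

/-- The index of the `i`-th point of the packing proposed by a certificate. -/
def Certificate.point (c : Certificate) (i : ℕ) : ℕ := (c.2.getD i (0, [])).1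

/-- The word attached to the `i`-th point of the packing proposed by a certificate. -/
def Certificate.word (c : Certificate) (i : ℕ) : List ℕ := (c.2.getD i (0, [])).2

/-- The test of the `i`-th entry of a certificate, for the output entry `m` of an associate whose
initial segment `l` is known: the `i`-th point is more than `2⁻ⁿ` away from the earlier ones, and
the associate halts exactly on the word attached to it, which is the beginning of a name of every
point at distance at most `2⁻ⁿ`.  The distances are approximated by `D`. -/
def Certificate.entryTest (D : ℕ → ℕ → ℕ → ℕ) (m : ℕ) (l : List ℕ) (c : Certificate) (i : ℕ) :
    Bool :=
  (List.range i).all (fun j => farTest (D (c.point i) (c.point j) c.1.2) c.1.2 c.1.1) &&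
  ((List.range (c.word i).length).all (fun j =>
      nearTest (D ((c.word i).getD j 0) (c.point i) c.1.2) c.1.2 c.1.1 j &&
      decide (l[Encodable.encode (m :: (c.word i).take j)]? = some 0)) &&
    !decide (l.getD (Encodable.encode (m :: c.word i)) 0 = 0))

/-- The test of a certificate: all entries are correct, and their number is the size of
maximum packings. -/
def Certificate.test (D : ℕ → ℕ → ℕ → ℕ) (κ : ℕ → ℕ) (m : ℕ) (l : List ℕ) (c : Certificate) :
    Bool :=
  decide (c.2.length = κ c.1.1) && (List.range c.2.length).all (c.entryTest D m l)

/-- The output of an associate with initial segment `l` on the `i`-th word of a certificate. -/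
def Certificate.value (m : ℕ) (l : List ℕ) (c : Certificate) (i : ℕ) : ℕ :=
  l.getD (Encodable.encode (m :: c.word i)) 0 - 1

/-- A code of the sum of the rational numbers with codes `u 0, …, u (k - 1)`. -/
def sumCode (u : ℕ → ℕ) (k : ℕ) : ℕ :=
  Nat.rec 0 (fun i z => addCode z (u i)) k

/-- A code of the average of the outputs of an associate on the words of a certificate. -/
def Certificate.average (m : ℕ) (l : List ℕ) (c : Certificate) : ℕ :=
  divCode (sumCode (c.value m l) c.2.length) c.2.length

/-- The certificate with code `e` (and the empty one if there is none). -/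
def Certificate.ofCode (e : ℕ) : Certificate :=
  (Encodable.decode e).getD ((0, 0), [])

/-- One step of the integration algorithm for the output entry `m`, on the initial segment `l` of a
name of the integrand: certificates with code below the length of `l` are tested.  The answer is
in the format of an associate. -/
def integralStep (D : ℕ → ℕ → ℕ → ℕ) (κ : ℕ → ℕ) (m : ℕ) (l : List ℕ) : ℕ :=
  (((List.range l.length).find? fun e => (Certificate.ofCode e).test D κ m l).map
    fun e => (Certificate.ofCode e).average m l + 1).getD 0

/-- The associate of the integration algorithm. -/
def integralAssociate (D : ℕ → ℕ → ℕ → ℕ) (κ : ℕ → ℕ) (e : ℕ) : ℕ :=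
  integralStep D κ ((Encodable.decode (α := List ℕ) e).getD []).headI
    ((Encodable.decode (α := List ℕ) e).getD []).tail

/-! ### Computability of the algorithm -/

section Computability

variable {α : Type*} [Primcodable α]

lemma computable_range_all {f : α → ℕ} {p : α → ℕ → Bool} (hf : Computable f)
    (hp : Computable₂ p) : Computable fun a => (List.range (f a)).all (p a) := by
  refine (Computable.nat_rec (g := fun _ => true) (h := fun a (z : ℕ × Bool) => z.2 && p a z.1)
    hf (Computable.const true) (Primrec.and.to_comp.comp (Computable.snd.comp Computable.snd)
      (hp.comp Computable.fst (Computable.fst.comp Computable.snd)))).of_eq fun a => ?_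
  induction f a with
  | zero => rfl
  | succ k ih => simp only [ih, List.range_succ, List.all_append, List.all_cons, List.all_nil,
      Bool.and_true]

/-- Bounded search for a computable condition; unlike for `Primrec`, closure properties of
`Computable` for lists have to be derived from recursion on natural numbers. -/
lemma computable_range_find? {f : α → ℕ} {p : α → ℕ → Bool} (hf : Computable f)
    (hp : Computable₂ p) : Computable fun a => (List.range (f a)).find? (p a) := by
  refine (Computable.nat_rec (g := fun _ => none)
    (h := fun a (z : ℕ × Option ℕ) =>
      Option.casesOn z.2 (cond (p a z.1) (some z.1) none) some)
    hf (Computable.const none) (Computable.option_casesOn (Computable.snd.comp Computable.snd)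
      (Computable.cond (hp.comp Computable.fst (Computable.fst.comp Computable.snd))
        (Computable.option_some.comp (Computable.fst.comp Computable.snd)) (Computable.const none))
      (Computable.option_some.comp Computable.snd).to₂).to₂).of_eq fun a => ?_
  induction f a with
  | zero => rfl
  | succ k ih =>
    simp only [ih, List.range_succ, List.find?_append]
    cases (List.range k).find? (p a) <;> cases h : p a k <;> simp [h]

lemma primrec_two_pow : Primrec fun n : ℕ => 2 ^ n :=
  (Primrec.nat_rec₁ 1 (Primrec.nat_mul.comp (Primrec.const 2) Primrec.snd).to₂).of_eq fun n => by
    induction n with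
    | zero => rfl
    | succ n ih => rw [pow_succ, mul_comm, ← ih]

lemma primrec_addCode : Primrec₂ addCode := by
  have u2 : Primrec fun x : ℕ × ℕ => x.1.unpair.2 + 1 :=
    Primrec.succ.comp (Primrec.snd.comp (Primrec.unpair.comp Primrec.fst))
  have v2 : Primrec fun x : ℕ × ℕ => x.2.unpair.2 + 1 :=
    Primrec.succ.comp (Primrec.snd.comp (Primrec.unpair.comp Primrec.snd))
  have u1 : Primrec fun x : ℕ × ℕ => x.1.unpair.1.unpair :=
    Primrec.unpair.comp (Primrec.fst.comp (Primrec.unpair.comp Primrec.fst))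
  have v1 : Primrec fun x : ℕ × ℕ => x.2.unpair.1.unpair :=
    Primrec.unpair.comp (Primrec.fst.comp (Primrec.unpair.comp Primrec.snd))
  exact Primrec₂.natPair.comp (Primrec₂.natPair.comp
    (Primrec.nat_add.comp (Primrec.nat_mul.comp (Primrec.fst.comp u1) v2)
      (Primrec.nat_mul.comp (Primrec.fst.comp v1) u2))
    (Primrec.nat_add.comp (Primrec.nat_mul.comp (Primrec.snd.comp u1) v2)
      (Primrec.nat_mul.comp (Primrec.snd.comp v1) u2)))
    (Primrec.pred.comp (Primrec.nat_mul.comp u2 v2))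

lemma primrec_divCode : Primrec₂ divCode :=
  Primrec₂.natPair.comp (Primrec.fst.comp (Primrec.unpair.comp Primrec.fst))
    (Primrec.pred.comp (Primrec.nat_mul.comp
      (Primrec.succ.comp (Primrec.snd.comp (Primrec.unpair.comp Primrec.fst))) Primrec.snd))

lemma primrec_farTest {q s n : α → ℕ} (hq : Primrec q) (hs : Primrec s) (hn : Primrec n) :
    Primrec fun a => farTest (q a) (s a) (n a) := by
  have q1 := Primrec.unpair.comp (Primrec.fst.comp (Primrec.unpair.comp hq))
  have q2 := Primrec.succ.comp (Primrec.snd.comp (Primrec.unpair.comp hq))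
  have hs' := primrec_two_pow.comp hs
  have hn' := primrec_two_pow.comp hn
  exact PrimrecPred.decide (Primrec.nat_lt.comp
    (Primrec.nat_add.comp
      (Primrec.nat_mul.comp (Primrec.snd.comp q1) (Primrec.nat_mul.comp hs' hn'))
      (Primrec.nat_mul.comp q2 (Primrec.nat_add.comp hs' hn')))
    (Primrec.nat_mul.comp (Primrec.fst.comp q1) (Primrec.nat_mul.comp hs' hn')))

lemma primrec_nearTest {q s n j : α → ℕ} (hq : Primrec q) (hs : Primrec s) (hn : Primrec n)
    (hj : Primrec j) : Primrec fun a => nearTest (q a) (s a) (n a) (j a) := by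
  have q1 := Primrec.unpair.comp (Primrec.fst.comp (Primrec.unpair.comp hq))
  have q2 := Primrec.succ.comp (Primrec.snd.comp (Primrec.unpair.comp hq))
  have hs' := primrec_two_pow.comp hs
  have hn' := primrec_two_pow.comp hn
  have hj' := primrec_two_pow.comp hj
  have hsnj := Primrec.nat_mul.comp (Primrec.nat_mul.comp hs' hn') hj'
  exact PrimrecPred.decide (Primrec.nat_le.comp
    (Primrec.nat_add.comp (Primrec.nat_mul.comp (Primrec.fst.comp q1) hsnj)
      (Primrec.nat_mul.comp q2
        (Primrec.nat_add.comp (Primrec.nat_mul.comp hn' hj') (Primrec.nat_mul.comp hs' hj'))))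
    (Primrec.nat_add.comp (Primrec.nat_mul.comp (Primrec.snd.comp q1) hsnj)
      (Primrec.nat_mul.comp q2 (Primrec.nat_mul.comp hs' hn'))))

lemma computable_farTest {q s n : α → ℕ} (hq : Computable q) (hs : Computable s)
    (hn : Computable n) : Computable fun a => farTest (q a) (s a) (n a) := by
  have h : Primrec fun t : ℕ × ℕ × ℕ => farTest t.1 t.2.1 t.2.2 :=
    primrec_farTest Primrec.fst (Primrec.fst.comp Primrec.snd) (Primrec.snd.comp Primrec.snd)
  have h' := h.to_comp.comp (hq.pair (hs.pair hn))
  exact h'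

lemma computable_nearTest {q s n j : α → ℕ} (hq : Computable q) (hs : Computable s)
    (hn : Computable n) (hj : Computable j) :
    Computable fun a => nearTest (q a) (s a) (n a) (j a) := by
  have h : Primrec fun t : ℕ × ℕ × ℕ × ℕ => nearTest t.1 t.2.1 t.2.2.1 t.2.2.2 :=
    primrec_nearTest Primrec.fst (Primrec.fst.comp Primrec.snd)
      (Primrec.fst.comp (Primrec.snd.comp Primrec.snd))
      (Primrec.snd.comp (Primrec.snd.comp Primrec.snd))
  have h' := h.to_comp.comp (hq.pair (hs.pair (hn.pair hj)))
  exact h'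

lemma primrec_point : Primrec₂ Certificate.point :=
  Primrec.fst.comp ((Primrec.list_getD (0, [])).comp (Primrec.snd.comp Primrec.fst) Primrec.snd)

lemma primrec_word : Primrec₂ Certificate.word :=
  Primrec.snd.comp ((Primrec.list_getD (0, [])).comp (Primrec.snd.comp Primrec.fst) Primrec.snd)

lemma primrec_value :
    Primrec₂ fun (t : (ℕ × List ℕ) × Certificate) (i : ℕ) => t.2.value t.1.1 t.1.2 i :=
  Primrec.pred.comp ((Primrec.list_getD 0).comp
    (Primrec.snd.comp (Primrec.fst.comp Primrec.fst))
    (Primrec.encode.comp (Primrec.list_cons.comp (Primrec.fst.comp (Primrec.fst.comp Primrec.fst))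
      (primrec_word.comp (Primrec.snd.comp Primrec.fst) Primrec.snd))))

lemma primrec_average :
    Primrec fun t : (ℕ × List ℕ) × Certificate => t.2.average t.1.1 t.1.2 := by
  have hlen : Primrec fun t : (ℕ × List ℕ) × Certificate => t.2.2.length :=
    Primrec.list_length.comp (Primrec.snd.comp Primrec.snd)
  exact primrec_divCode.comp (Primrec.nat_rec' hlen (Primrec.const 0)
    (primrec_addCode.comp (Primrec.snd.comp Primrec.snd)
      (primrec_value.comp Primrec.fst (Primrec.fst.comp Primrec.snd))).to₂) hlen

lemma computable_entryTest {D : ℕ → ℕ → ℕ → ℕ}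
    (hD : Computable fun t : ℕ × ℕ × ℕ => D t.1 t.2.1 t.2.2) :
    Computable₂ fun (t : (ℕ × List ℕ) × Certificate) (i : ℕ) =>
      t.2.entryTest D t.1.1 t.1.2 i := by
  have hm : Primrec fun t : (ℕ × List ℕ) × Certificate => t.1.1 := Primrec.fst.comp Primrec.fst
  have hl : Primrec fun t : (ℕ × List ℕ) × Certificate => t.1.2 := Primrec.snd.comp Primrec.fst
  have hn : Primrec fun t : (ℕ × List ℕ) × Certificate => t.2.1.1 :=
    Primrec.fst.comp (Primrec.fst.comp Primrec.snd)
  have hs : Primrec fun t : (ℕ × List ℕ) × Certificate => t.2.1.2 :=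
    Primrec.snd.comp (Primrec.fst.comp Primrec.snd)
  have hw : Primrec fun t : ((ℕ × List ℕ) × Certificate) × ℕ => t.1.2.word t.2 :=
    primrec_word.comp (Primrec.snd.comp Primrec.fst) Primrec.snd
  have hp : Primrec fun t : ((ℕ × List ℕ) × Certificate) × ℕ => t.1.2.point t.2 :=
    primrec_point.comp (Primrec.snd.comp Primrec.fst) Primrec.snd
  have ctx : Primrec fun t : (((ℕ × List ℕ) × Certificate) × ℕ) × ℕ => t.1.1 :=
    Primrec.fst.comp Primrec.fst
  have hj : Primrec fun t : (((ℕ × List ℕ) × Certificate) × ℕ) × ℕ => t.2 := Primrec.snd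
  have hDfar := hD.comp ((hp.comp Primrec.fst).to_comp.pair
    ((primrec_point.comp (Primrec.snd.comp ctx) hj).to_comp.pair (hs.comp ctx).to_comp))
  have hfar := computable_farTest hDfar (hs.comp ctx).to_comp (hn.comp ctx).to_comp
  have hDnear := hD.comp (((Primrec.list_getD 0).comp (hw.comp Primrec.fst) hj).to_comp.pair
    ((hp.comp Primrec.fst).to_comp.pair (hs.comp ctx).to_comp))
  have hnear := computable_nearTest hDnear (hs.comp ctx).to_comp (hn.comp ctx).to_comp hj.to_comp
  have hrun : Primrec₂ fun (t : ((ℕ × List ℕ) × Certificate) × ℕ) (j : ℕ) =>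
      decide (t.1.1.2[Encodable.encode (t.1.1.1 :: (t.1.2.word t.2).take j)]? = some 0) :=
    PrimrecPred.decide (Primrec.eq.comp (Primrec.list_getElem?.comp (hl.comp ctx)
      (Primrec.encode.comp (Primrec.list_cons.comp (hm.comp ctx)
        (Primrec.list_take.comp hj (hw.comp Primrec.fst))))) (Primrec.const (some 0)))
  have hhalt : Primrec fun t : ((ℕ × List ℕ) × Certificate) × ℕ =>
      !decide (t.1.1.2.getD (Encodable.encode (t.1.1.1 :: t.1.2.word t.2)) 0 = 0) :=
    Primrec.not.comp (PrimrecPred.decide (Primrec.eq.comp ((Primrec.list_getD 0).comp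
      (hl.comp Primrec.fst) (Primrec.encode.comp (Primrec.list_cons.comp (hm.comp Primrec.fst) hw)))
      (Primrec.const 0)))
  have h1 := computable_range_all Computable.snd hfar.to₂
  have h2 := computable_range_all (Primrec.list_length.comp hw).to_comp
    (Primrec.and.to_comp.comp₂ hnear.to₂ hrun.to_comp)
  exact (Primrec.and.to_comp.comp h1 (Primrec.and.to_comp.comp h2 hhalt.to_comp)).of_eq
    fun _ => rfl

lemma computable_test {D : ℕ → ℕ → ℕ → ℕ} {κ : ℕ → ℕ}
    (hD : Computable fun t : ℕ × ℕ × ℕ => D t.1 t.2.1 t.2.2) (hκ : Computable κ) :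
    Computable fun t : (ℕ × List ℕ) × Certificate => t.2.test D κ t.1.1 t.1.2 := by
  have hlen : Primrec fun t : (ℕ × List ℕ) × Certificate => t.2.2.length :=
    Primrec.list_length.comp (Primrec.snd.comp Primrec.snd)
  have heq : Primrec₂ fun a b : ℕ => decide (a = b) := PrimrecPred.decide Primrec.eq
  exact Primrec.and.to_comp.comp (heq.to_comp.comp hlen.to_comp
      (hκ.comp (Computable.fst.comp (Computable.fst.comp Computable.snd))))
    (computable_range_all hlen.to_comp (computable_entryTest hD))

lemma primrec_ofCode : Primrec Certificate.ofCode :=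
  Primrec.option_getD.comp Primrec.decode (Primrec.const _)

lemma computable_integralStep {D : ℕ → ℕ → ℕ → ℕ} {κ : ℕ → ℕ}
    (hD : Computable fun t : ℕ × ℕ × ℕ => D t.1 t.2.1 t.2.2) (hκ : Computable κ) :
    Computable₂ (integralStep D κ) := by
  have hctx : Computable fun t : (ℕ × List ℕ) × ℕ => (t.1, Certificate.ofCode t.2) :=
    Computable.fst.pair (primrec_ofCode.to_comp.comp Computable.snd)
  exact Computable.option_getD (Computable.option_map
    (computable_range_find? (Computable.list_length.comp Computable.snd)
      ((computable_test hD hκ).comp hctx).to₂)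
    (Computable.succ.comp (primrec_average.to_comp.comp hctx)).to₂) (Computable.const 0)

lemma computable_integralAssociate {D : ℕ → ℕ → ℕ → ℕ} {κ : ℕ → ℕ}
    (hD : Computable fun t : ℕ × ℕ × ℕ => D t.1 t.2.1 t.2.2) (hκ : Computable κ) :
    Computable (integralAssociate D κ) := by
  have hdec : Primrec fun e : ℕ => (Encodable.decode (α := List ℕ) e).getD [] :=
    Primrec.option_getD.comp Primrec.decode (Primrec.const _)
  exact (computable_integralStep hD hκ).comp (Primrec.list_headI.comp hdec).to_comp
    (Primrec.list_tail.comp hdec).to_comp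

end Computability

/-! ### Correctness of the algorithm -/

lemma ratCode_sumCode (u : ℕ → ℕ) (k : ℕ) :
    ratCode (sumCode u k) = ∑ i : Fin k, ratCode (u i) := by
  induction k with
  | zero => simp [sumCode, ratCode]
  | succ k ih =>
    rw [Fin.sum_univ_castSucc]
    exact (ratCode_addCode _ _).trans (congrArg (· + _) ih)

/-- The meaning of the test when the known initial segment has length `k`: all queries are below
`k`, and the answers are those of `α`. -/
lemma test_initSeg_iff {D : ℕ → ℕ → ℕ → ℕ} {κ : ℕ → ℕ} {α : ℕ → ℕ} {m k : ℕ} {c : Certificate} :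
    c.test D κ m (initSeg α k) = true ↔ c.2.length = κ c.1.1 ∧ ∀ i < c.2.length,
      (∀ j < i, farTest (D (c.point i) (c.point j) c.1.2) c.1.2 c.1.1 = true) ∧
      (∀ j < (c.word i).length,
        nearTest (D ((c.word i).getD j 0) (c.point i) c.1.2) c.1.2 c.1.1 j = true ∧
        Encodable.encode (m :: (c.word i).take j) < k) ∧
      Encodable.encode (m :: c.word i) < k ∧ HaltsOn α m (c.word i) := by
  have hget : ∀ e, (initSeg α k).getD e 0 ≠ 0 ↔ e < k ∧ α e ≠ 0 := by
    intro e
    by_cases he : e < k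
    · rw [getD_initSeg α he]
      exact (and_iff_right he).symm
    · simp [initSeg, he]
  simp only [Certificate.test, Certificate.entryTest, Bool.and_eq_true, decide_eq_true_iff,
    List.all_eq_true, List.mem_range, Bool.not_eq_true', decide_eq_false_iff_not,
    getElem?_initSeg_eq_some_iff, hget, HaltsOn]
  grind

/-- Soundness: every certificate that passes the test gives a correct output. -/
lemma abs_ratCode_average_sub_integral_le {X : Type*} [MetricSpace X] [CompactSpace X] [Group X]
    [IsTopologicalGroup X] [MeasurableSpace X] [BorelSpace X]
    (hinv : ∀ a b c : X, dist (a * c) (b * c) = dist a b)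
    (μ : Measure X) [IsProbabilityMeasure μ] [μ.IsMulLeftInvariant] {ξ : ℕ → X}
    {hξ : DenseRange ξ} {D : ℕ → ℕ → ℕ → ℕ} (hD : ∀ a b, realRep.IsName (D a b) (dist (ξ a) (ξ b)))
    {f : C(X, ℝ)} {α : ℕ → ℕ} (hα : Realizes (cauchyRep ξ hξ) realRep α f) {m k : ℕ}
    {c : Certificate} (hc : c.test D (packingSize X) m (initSeg α k) = true) :
    |ratCode (c.average m (initSeg α k)) - ∫ x, f x ∂μ| ≤ (1 / 2 : ℝ) ^ m := by
  rw [test_initSeg_iff] at hc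
  obtain ⟨hlen, hc⟩ := hc
  have hdist : ∀ a b s, |ratCode (D a b s) - dist (ξ a) (ξ b)| ≤ (1 / 2 : ℝ) ^ s := fun a b s =>
    hD a b s
  have hne : c.2.length ≠ 0 := by
    rw [hlen]
    exact packingSize_ne_zero _
  have hlt : ∀ i < c.2.length, ∀ j < i,
      (1 / 2 : ℝ) ^ c.1.1 < dist (ξ (c.point i)) (ξ (c.point j)) := by
    intro i hi j hj
    have h1 := farTest_iff.1 ((hc i hi).1 j hj)
    have h2 := abs_le.1 (hdist (c.point i) (c.point j) c.1.2)
    linarith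
  rw [Certificate.average, ratCode_divCode _ hne, ratCode_sumCode]
  refine abs_average_sub_integral_le hinv μ f (ε := (1 / 2 : ℝ) ^ c.1.1) (by positivity) hne
    (hlen ▸ card_le_packingSize c.1.1) (a := fun i => ξ (c.point i)) ?_ ?_
  · intro i j hij
    rcases lt_or_gt_of_ne hij with h | h
    · exact (hlt j j.2 i h).trans_eq (dist_comm _ _)
    · exact hlt i i.2 j h
  · intro i y hy
    obtain ⟨-, hnear, hik, hhalt⟩ := hc i i.2
    rw [Certificate.value, getD_initSeg α hik]
    refine dist_output_le hα hhalt fun j hj => ?_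
    have h1 := nearTest_iff.1 (hnear j hj).1
    have h2 := abs_le.1 (hdist ((c.word i).getD j 0) (c.point i) c.1.2)
    have h3 := dist_triangle (ξ ((c.word i).getD j 0)) (ξ (c.point i)) y
    linarith

/-- Completeness: for every output entry, some certificate passes the test on some initial segment
of the name of the integrand. -/
lemma exists_test {X : Type*} [MetricSpace X] [CompactSpace X] {ξ : ℕ → X}
    {hξ : DenseRange ξ} {D : ℕ → ℕ → ℕ → ℕ} (hD : ∀ a b, realRep.IsName (D a b) (dist (ξ a) (ξ b)))
    {f : X → ℝ} {α : ℕ → ℕ} (hα : Realizes (cauchyRep ξ hξ) realRep α f) (m : ℕ) :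
    ∃ k, ∃ e < k, (Certificate.ofCode e).test D (packingSize X) m (initSeg α k) = true := by
  obtain ⟨n, hn⟩ := exists_uniform_haltsOn hα m
  obtain ⟨a, ha⟩ := exists_dense_packing hξ n
  choose w hw hwd using fun i => hn (ξ (a i))
  have htend : Filter.Tendsto (fun s : ℕ => 2 * (1 / 2 : ℝ) ^ s) Filter.atTop (𝓝 0) := by
    simpa using (tendsto_pow_atTop_nhds_zero_of_lt_one (r := (1 / 2 : ℝ)) (by norm_num)
      (by norm_num)).const_mul 2
  have hdist : ∀ a b s, |ratCode (D a b s) - dist (ξ a) (ξ b)| ≤ (1 / 2 : ℝ) ^ s := fun a b s =>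
    hD a b s
  -- The finitely many strict inequalities are verified with sufficient precision.
  have hev : ∀ᶠ s : ℕ in Filter.atTop, ∀ i,
      (∀ j, i ≠ j → farTest (D (a i) (a j) s) s n = true) ∧
      ∀ j : Fin (w i).length, nearTest (D ((w i).getD j 0) (a i) s) s n j = true := by
    refine Filter.eventually_all.2 fun i => (Filter.eventually_all.2 fun j =>
      Filter.eventually_imp_distrib_left.2 fun hij => ?_).and (Filter.eventually_all.2 fun j => ?_)
    · filter_upwards [htend.eventually (gt_mem_nhds (sub_pos.2 (ha hij)))] with s hs
      have := abs_le.1 (hdist (a i) (a j) s)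
      exact farTest_iff.2 (by linarith)
    · filter_upwards [htend.eventually (gt_mem_nhds (sub_pos.2 (hwd i j j.2)))] with s hs
      have := abs_le.1 (hdist ((w i).getD j 0) (a i) s)
      exact nearTest_iff.2 (by linarith)
  obtain ⟨s, hs⟩ := hev.exists
  let c : Certificate := ((n, s), List.ofFn fun i => (a i, w i))
  have hlen : c.2.length = packingSize X n := List.length_ofFn
  have hpoint : ∀ i : Fin (packingSize X n), c.point i = a i := fun i => by
    simp [Certificate.point, c]
  have hword : ∀ i : Fin (packingSize X n), c.word i = w i := fun i => by
    simp [Certificate.word, c]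
  -- A bound for all the places at which the associate is queried.
  obtain ⟨k, hk⟩ : ∃ k, Encodable.encode c < k ∧ ∀ i : Fin (packingSize X n),
      (∀ j : Fin (w i).length, Encodable.encode (m :: (w i).take j) < k) ∧
      Encodable.encode (m :: w i) < k :=
    ((Filter.eventually_gt_atTop _).and (Filter.eventually_all.2 fun i =>
      (Filter.eventually_all.2 fun j => Filter.eventually_gt_atTop _).and
        (Filter.eventually_gt_atTop _))).exists
  refine ⟨k, Encodable.encode c, hk.1, ?_⟩
  rw [Certificate.ofCode, Encodable.encodek, Option.getD_some, test_initSeg_iff]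
  refine ⟨hlen, fun i hi => ?_⟩
  obtain ⟨i, rfl⟩ : ∃ i' : Fin (packingSize X n), (i' : ℕ) = i := ⟨⟨i, hlen ▸ hi⟩, rfl⟩
  rw [hpoint, hword]
  refine ⟨fun j hj => ?_, fun j hj => ⟨(hs i).2 ⟨j, hj⟩, (hk.2 i).1 ⟨j, hj⟩⟩, (hk.2 i).2, hw i⟩
  have := (hs i).1 ⟨j, hj.trans i.2⟩ (Fin.ne_of_gt hj)
  rwa [← hpoint ⟨j, hj.trans i.2⟩] at this

lemma integralAssociate_encode (D : ℕ → ℕ → ℕ → ℕ) (κ : ℕ → ℕ) (m : ℕ) (l : List ℕ) :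
    integralAssociate D κ (Encodable.encode (m :: l)) = integralStep D κ m l := by
  simp only [integralAssociate, Encodable.encodek, Option.getD_some, List.headI_cons,
    List.tail_cons]

lemma integralStep_initSeg_ne_zero_iff {D : ℕ → ℕ → ℕ → ℕ} {κ : ℕ → ℕ} {m k : ℕ} {α : ℕ → ℕ} :
    integralStep D κ m (initSeg α k) ≠ 0 ↔
      ∃ e < k, (Certificate.ofCode e).test D κ m (initSeg α k) = true := by
  rw [integralStep, length_initSeg]
  cases h : (List.range k).find? fun e => (Certificate.ofCode e).test D κ m (initSeg α k) with
  | none =>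
    simp only [List.find?_eq_none, List.mem_range] at h
    simpa using h
  | some e =>
    simpa using ⟨e, List.mem_range.1 (List.mem_of_find?_eq_some h),
      List.find?_some (p := fun e => (Certificate.ofCode e).test D κ m (initSeg α k)) h⟩

lemma exists_of_integralStep_eq_succ {D : ℕ → ℕ → ℕ → ℕ} {κ : ℕ → ℕ} {m v : ℕ} {l : List ℕ}
    (h : integralStep D κ m l = v + 1) :
    ∃ c : Certificate, c.test D κ m l = true ∧ c.average m l = v := by
  rw [integralStep] at h
  cases h' : (List.range l.length).find? fun e => (Certificate.ofCode e).test D κ m l with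
  | none => simp [h'] at h
  | some e =>
    refine ⟨Certificate.ofCode e,
      List.find?_some (p := fun e => (Certificate.ofCode e).test D κ m l) h', ?_⟩
    simpa [h'] using h

end HaarComp

theorem mainTheorem3 {X : Type*} [MetricSpace X] [CompactSpace X] [Group X] [IsTopologicalGroup X]
    [MeasurableSpace X] [BorelSpace X]
    (S : HaarComp.ComputableMetricSpace X)
    (hbi : ∀ a b c : X, dist (a * c) (b * c) = dist a b ∧ dist (c * a) (c * b) = dist a b)
    (hκ : Computable (HaarComp.packingSize X))
    (μ : Measure X) [IsProbabilityMeasure μ] [μ.IsMulLeftInvariant] :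
    HaarComp.ComputableMap S.functionRep HaarComp.realRep (fun f : C(X, ℝ) => ∫ x, f x ∂μ) := by
  obtain ⟨D, hD, hname⟩ := S.computable_dist
  refine ⟨HaarComp.integralAssociate D (HaarComp.packingSize X),
    HaarComp.computable_integralAssociate hD hκ, fun α f hα => ?_⟩
  have hout : ∀ m, ∃ v, (∃ k,
      HaarComp.integralStep D (HaarComp.packingSize X) m (HaarComp.initSeg α k) = v + 1 ∧
      ∀ j < k,
        HaarComp.integralStep D (HaarComp.packingSize X) m (HaarComp.initSeg α j) = 0) ∧
      |HaarComp.ratCode v - ∫ x, f x ∂μ| ≤ (1 / 2 : ℝ) ^ m := by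
    intro m
    have hex : ∃ k,
        HaarComp.integralStep D (HaarComp.packingSize X) m (HaarComp.initSeg α k) ≠ 0 := by
      obtain ⟨k, hk⟩ := HaarComp.exists_test hname hα m
      exact ⟨k, HaarComp.integralStep_initSeg_ne_zero_iff.2 hk⟩
    classical
    obtain ⟨v, hv⟩ := Nat.exists_eq_succ_of_ne_zero (Nat.find_spec hex)
    obtain ⟨c, hc, rfl⟩ := HaarComp.exists_of_integralStep_eq_succ hv
    exact ⟨_, ⟨_, hv, fun j hj => not_not.1 (Nat.find_min hex hj)⟩,
      HaarComp.abs_ratCode_average_sub_integral_le (fun a b c => (hbi a b c).1) μ hname hα hc⟩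
  choose q hq hqd using hout
  refine ⟨q, fun m => ?_, hqd⟩
  simpa only [HaarComp.integralAssociate_encode] using hq m
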